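/- Let $p$ be a prime and let $U$ be a uniform pro-$p$ group, i.e. a topologically finitely generated pro-$p$ group such that $U/\overline{U^p}$ is abelian if $p$ is odd (respectively $U/\overline{U^4}$ is abelian if $p=2$) and such that $|P_i(U):P_{i+1}(U)| = |U:P_2(U)|$ for all $i\ge 1$, where $P_1(U)=U$ and $P_{i+1}(U)=\overline{P_i(U)^p[P_i(U),U]}$. (Here $H^n$ denotes the subgroup generated by the $n$-th powers of the elements of $H$, and the bar denotes topological closure.) Let $G$ be a (not necessarily closed) subgroup of $U$ that is virtually abelian, i.e. $G$ has an abelian subgroup of finite index. Then $G$ is abelian. -/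

import Mathlib

/-- `G` is a pro-`p` group: a profinite (compact, totally disconnected) topological group all of
whose open normal subgroups have index a power of `p`. -/
structure IsProP (p : ℕ) (G : Type*) [Group G] [TopologicalSpace G]
    [IsTopologicalGroup G] : Prop where
  compactSpace : CompactSpace G
  totallyDisconnectedSpace : TotallyDisconnectedSpace G
  index_eq_pow : ∀ N : Subgroup G, N.Normal → IsOpen (N : Set G) → ∃ k : ℕ, N.index = p ^ k

/-- `H ^ n`: the (abstract) subgroup generated by the `n`-th powers of the elements of `H`. -/
def powerSubgroup {G : Type*} [Group G] (H : Subgroup G) (n : ℕ) : Subgroup G :=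
  Subgroup.closure ((fun x : G => x ^ n) '' (H : Set G))

/-- Topological finite generation: some finite subset generates a dense subgroup. -/
def IsTopFinGen (G : Type*) [Group G] [TopologicalSpace G] [IsTopologicalGroup G] : Prop :=
  ∃ S : Finset G, (Subgroup.closure (S : Set G)).topologicalClosure = ⊤

/-- A pro-`p` group `G` is powerful if the quotient of `G` by the closure of `G ^ p`
(of `G ^ 4` if `p = 2`) is abelian, that is, if this closure contains all commutators. -/
def IsPowerfulProP (p : ℕ) (G : Type*) [Group G] [TopologicalSpace G] [IsTopologicalGroup G] :
    Prop :=
  commutator G ≤ (powerSubgroup (⊤ : Subgroup G) (if p = 2 then 4 else p)).topologicalClosure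

/-- The lower `p`-series of `G`: `P₁(G) = G` and `Pᵢ₊₁(G)` is the closure of `Pᵢ(G) ^ p [Pᵢ(G), G]`.
The indexing starts at `0`, so `lowerPSeries p G i` is `Pᵢ₊₁(G)`. -/
def lowerPSeries (p : ℕ) (G : Type*) [Group G] [TopologicalSpace G] [IsTopologicalGroup G] :
    ℕ → Subgroup G
  | 0 => ⊤
  | i + 1 => (powerSubgroup (lowerPSeries p G i) p ⊔
      ⁅lowerPSeries p G i, (⊤ : Subgroup G)⁆).topologicalClosure

/-- `G` is a uniform (uniformly powerful) pro-`p` group: a topologically finitely generated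
powerful pro-`p` group with `|Pᵢ(G) : Pᵢ₊₁(G)| = |G : P₂(G)|` for all `i ≥ 1`
(these indices are finite, since `G` is finitely generated). -/
structure IsUniformProP (p : ℕ) (G : Type*) [Group G] [TopologicalSpace G]
    [IsTopologicalGroup G] : Prop where
  isProP : IsProP p G
  isTopFinGen : IsTopFinGen G
  isPowerful : IsPowerfulProP p G
  relIndex_eq : ∀ i : ℕ,
    (lowerPSeries p G (i + 1)).relIndex (lowerPSeries p G i) = (lowerPSeries p G 1).index

/-- A group is virtually abelian if it has an abelian subgroup of finite index. -/
def IsVirtuallyAbelian (G : Type*) [Group G] : Prop :=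
  ∃ A : Subgroup G, IsMulCommutative A ∧ A.FiniteIndex

open scoped commutatorElement

/-! ### Class-two power and commutator identities. -/

section GroupLemmas

variable {Q : Type*} [Group Q]

/-! Roots in `U` are unique. So if `x ^ n` commutes with `y`, the conjugate of `x` by `y` has the
same `n`-th power as `x` and equals it. Applied twice, this turns commuting powers, supplied by the
abelian subgroup, into commuting elements.

For exponents prime to `p`, uniqueness is checked in finite `p`-quotients. For exponent `p`, write P
i for `lowerPSeries p U i`. Powerfulness makes the `p`-power map a homomorphism from P i onto P
(i+1) / P (i+2); equality of the finite indices makes its kernel exactly P (i+1)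
(`mem_lowerPSeries_succ_of_pow_mem`). Hence `x ^ p = y ^ p` pushes `x⁻¹ * y` down the whole series,
whose intersection is trivial. -/

theorem pow_mul_eq_of_central {x w c : Q} (hc : ∀ g, Commute c g) (h : w * x = x * w * c) (n : ℕ) :
    w ^ n * x = x * w ^ n * c ^ n := by
  induction n with
  | zero => simp
  | succ n ih =>
    have hcn : c * w ^ n = w ^ n * c := (hc _).eq
    calc w ^ (n + 1) * x = w * (w ^ n * x) := by rw [pow_succ', mul_assoc]
      _ = (w * x) * w ^ n * c ^ n := by rw [ih]; group
      _ = x * w * (c * w ^ n) * c ^ n := by rw [h]; simp only [mul_assoc]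
      _ = x * w ^ (n + 1) * c ^ (n + 1) := by
        rw [hcn, pow_succ' w, pow_succ' c]; simp only [mul_assoc]

/-- The class-two power formula, for a pair of elements whose commutator `c` is central. -/
theorem mul_pow_of_central {x w c : Q} (hc : ∀ g, Commute c g) (h : w * x = x * w * c) (n : ℕ) :
    (x * w) ^ n = x ^ n * w ^ n * c ^ (n.choose 2) := by
  induction n with
  | zero => simp
  | succ n ih =>
    have h1 : c ^ n.choose 2 * (x * w) = x * w * c ^ n.choose 2 := ((hc _).pow_left _).eq
    have h2 : c ^ n * w = w * c ^ n := ((hc _).pow_left _).eq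
    calc (x * w) ^ (n + 1) = x ^ n * w ^ n * (c ^ n.choose 2 * (x * w)) := by
          rw [pow_succ, ih, mul_assoc]
      _ = x ^ n * (w ^ n * x) * w * c ^ n.choose 2 := by rw [h1]; simp only [mul_assoc]
      _ = x ^ n * (x * w ^ n) * (c ^ n * w) * c ^ n.choose 2 := by
          rw [pow_mul_eq_of_central hc h]; simp only [mul_assoc]
      _ = x ^ (n + 1) * w ^ (n + 1) * c ^ (n + 1).choose 2 := by
          have h3 : (n + 1).choose 2 = n + n.choose 2 := by
            rw [Nat.choose_succ_succ' n 1, Nat.choose_one_right]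
          rw [h2, h3, pow_add c, pow_succ x n, pow_succ w n]
          simp only [mul_assoc]

theorem commutatorElement_mul_eq_inv {a b k z : Q} (hz : Commute z b) (hk : Commute k a)
    (h : b * a = a * k * b) : ⁅a * z, b⁆ = k⁻¹ := by
  calc ⁅a * z, b⁆ = a * (z * b * z⁻¹) * a⁻¹ * b⁻¹ := by
        simp only [commutatorElement_def, mul_inv_rev, mul_assoc]
    _ = a * b * (b * a)⁻¹ := by
        rw [hz.eq, mul_inv_cancel_right, mul_inv_rev]; simp only [mul_assoc]
    _ = (a * k⁻¹) * a⁻¹ := by rw [h]; group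
    _ = k⁻¹ := by rw [← hk.inv_left.eq, mul_inv_cancel_right]

theorem commutatorElement_mem_iff_commute {N : Subgroup Q} [N.Normal] (x g : Q) :
    ⁅x, g⁆ ∈ N ↔ Commute (x : Q ⧸ N) (g : Q ⧸ N) := by
  rw [← commutatorElement_eq_one_iff_commute, ← QuotientGroup.eq_one_iff]
  rfl

theorem powerSubgroup_le {H K : Subgroup Q} {n : ℕ} :
    powerSubgroup H n ≤ K ↔ ∀ x ∈ H, x ^ n ∈ K := by
  simp [powerSubgroup, Subgroup.closure_le, Set.subset_def]

theorem pow_mem_powerSubgroup {H : Subgroup Q} {x : Q} (hx : x ∈ H) (n : ℕ) :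
    x ^ n ∈ powerSubgroup H n :=
  Subgroup.subset_closure ⟨x, hx, rfl⟩

instance powerSubgroup_normal (H : Subgroup Q) [hH : H.Normal] (n : ℕ) :
    (powerSubgroup H n).Normal := by
  have hle : ∀ g : Q, powerSubgroup H n ≤
      (powerSubgroup H n).comap (MulAut.conj g).toMonoidHom := fun g ↦
    powerSubgroup_le.2 fun x hx ↦ by
      rw [Subgroup.mem_comap, map_pow]
      exact pow_mem_powerSubgroup (hH.conj_mem x hx g) n
  exact ⟨fun x hx g ↦ hle g hx⟩

end GroupLemmas

/-! ### The lower `p`-series and finite quotients. -/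

section LowerPSeries

variable {p : ℕ} {G : Type*} [Group G] [TopologicalSpace G] [IsTopologicalGroup G]

instance lowerPSeries_normal (i : ℕ) : (lowerPSeries p G i).Normal := by
  induction i with
  | zero => exact inferInstanceAs (⊤ : Subgroup G).Normal
  | succ i ih => exact Subgroup.is_normal_topologicalClosure _

theorem isClosed_lowerPSeries (i : ℕ) : IsClosed (lowerPSeries p G i : Set G) := by
  cases i with
  | zero => exact isClosed_univ
  | succ i => exact Subgroup.isClosed_topologicalClosure _

theorem pow_mem_lowerPSeries_succ {i : ℕ} {x : G} (hx : x ∈ lowerPSeries p G i) :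
    x ^ p ∈ lowerPSeries p G (i + 1) :=
  Subgroup.le_topologicalClosure _ (Subgroup.mem_sup_left (pow_mem_powerSubgroup hx p))

theorem commutator_mem_lowerPSeries_succ {i : ℕ} {x : G} (hx : x ∈ lowerPSeries p G i) (g : G) :
    ⁅x, g⁆ ∈ lowerPSeries p G (i + 1) :=
  Subgroup.le_topologicalClosure _
    (Subgroup.mem_sup_right (Subgroup.commutator_mem_commutator hx (Subgroup.mem_top g)))

theorem lowerPSeries_succ_le_of_isClosed {i : ℕ} {N : Subgroup G} (hN : IsClosed (N : Set G))
    (hpow : ∀ x ∈ lowerPSeries p G i, x ^ p ∈ N)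
    (hcomm : ∀ x ∈ lowerPSeries p G i, ∀ g, ⁅x, g⁆ ∈ N) : lowerPSeries p G (i + 1) ≤ N :=
  Subgroup.topologicalClosure_minimal _
    (sup_le (powerSubgroup_le.2 hpow) (Subgroup.commutator_le.2 fun x hx g _ ↦ hcomm x hx g)) hN

theorem lowerPSeries_succ_le (i : ℕ) : lowerPSeries p G (i + 1) ≤ lowerPSeries p G i :=
  lowerPSeries_succ_le_of_isClosed (isClosed_lowerPSeries i) (fun _ hx ↦ pow_mem hx p)
    fun _ hx g ↦ Subgroup.commutator_le_left _ ⊤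
      (Subgroup.commutator_mem_commutator hx (Subgroup.mem_top g))

/-- The quotient is abelian of exponent dividing `p`, so a finite set generates a finite subgroup
`T` there. The preimage of `T` is closed and contains a dense subgroup, so `T` is everything. -/
theorem finite_quotient_lowerPSeries_one (hp : p ≠ 0) (hG : IsTopFinGen G) :
    Finite (G ⧸ lowerPSeries p G 1) := by
  obtain ⟨S, hS⟩ := hG
  let N := lowerPSeries p G 1
  have : IsClosed (N : Set G) := isClosed_lowerPSeries 1
  let : CommGroup (G ⧸ N) :=
    { (inferInstance : Group (G ⧸ N)) with
      mul_comm := fun a b ↦ by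
        induction a using QuotientGroup.induction_on with | H a
        induction b using QuotientGroup.induction_on with | H b
        exact (commutatorElement_mem_iff_commute a b).1
          (commutator_mem_lowerPSeries_succ (i := 0) (Subgroup.mem_top a) b) }
  let T : Subgroup (G ⧸ N) := (Subgroup.closure (S : Set G)).map (QuotientGroup.mk' N)
  have hfg : Group.FG T := by
    rw [show T = _ from MonoidHom.map_closure _ _]
    have : Finite (QuotientGroup.mk' N '' (S : Set G)) := (S.finite_toSet.image _).to_subtype
    exact Group.closure_finite_fg _
  have htors : IsMulTorsion T := fun t ↦ by
    obtain ⟨_, g, -, rfl⟩ := t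
    refine isOfFinOrder_iff_pow_eq_one.2 ⟨p, Nat.pos_of_ne_zero hp, Subtype.ext ?_⟩
    exact (QuotientGroup.eq_one_iff (g ^ p)).2
      (pow_mem_lowerPSeries_succ (i := 0) (Subgroup.mem_top g))
  have hfin : Finite T := CommGroup.finite_of_fg_isMulTorsion T htors
  have hcl : IsClosed (T.comap (QuotientGroup.mk' N) : Set G) :=
    (Set.toFinite (T : Set (G ⧸ N))).isClosed.preimage QuotientGroup.continuous_mk
  have htop : T.comap (QuotientGroup.mk' N) = ⊤ := by
    rw [eq_top_iff, ← hS]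
    exact Subgroup.topologicalClosure_minimal _ (Subgroup.le_comap_map _ _) hcl
  have : T = ⊤ := by
    rw [← Subgroup.map_comap_eq_self_of_surjective (QuotientGroup.mk'_surjective N) T, htop,
      Subgroup.map_top_of_surjective _ (QuotientGroup.mk'_surjective N)]
  rw [this] at hfin
  exact (Subgroup.topEquiv.toEquiv.finite_iff).1 hfin

/-- Induction on the index: enlarge `N` to `M` by a central subgroup of order `p` of the `p`-group
`G ⧸ N`. Then `p`-th powers and commutators of elements of `M` fall into `N`, so one more step of
the series suffices. -/
theorem exists_lowerPSeries_le [hp : Fact p.Prime] (hG : IsProP p G) (N : Subgroup G)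
    [N.Normal] (hN : IsOpen (N : Set G)) : ∃ i, lowerPSeries p G i ≤ N := by
  have := hG.compactSpace
  have hfin : Finite (G ⧸ N) := N.quotient_finite_of_isOpen hN
  induction hn : N.index using Nat.strong_induction_on generalizing N with
  | _ n ih =>
  by_cases htop : N = ⊤
  · exact ⟨0, htop ▸ le_top⟩
  have hpg : IsPGroup p (G ⧸ N) := by
    obtain ⟨k, hk⟩ := hG.index_eq_pow N inferInstance hN
    exact IsPGroup.of_card (n := k) (by rw [← hk]; rfl)
  have : Nontrivial (G ⧸ N) := QuotientGroup.nontrivial_iff.2 htop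
  have : Nontrivial (Subgroup.center (G ⧸ N)) := hpg.center_nontrivial
  obtain ⟨z, hz⟩ : ∃ z : Subgroup.center (G ⧸ N), orderOf z = p :=
    exists_prime_orderOf_dvd_card' p
      ((hpg.to_subgroup (Subgroup.center (G ⧸ N))).card_eq_or_dvd.resolve_left
        Finite.one_lt_card.ne')
  let Z : Subgroup (G ⧸ N) := Subgroup.zpowers (z : G ⧸ N)
  have hZc : Z ≤ Subgroup.center (G ⧸ N) := by simp [Z, z.2]
  have : Z.Normal := ⟨fun a ha g ↦ by
    rwa [Subgroup.mem_center_iff.1 (hZc ha) g, mul_inv_cancel_right]⟩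
  have hZp : ∀ y ∈ Z, y ^ p = 1 := by
    rintro _ ⟨k, rfl⟩
    have : (z : G ⧸ N) ^ p = 1 := by rw [← Subgroup.coe_pow, ← hz, pow_orderOf_eq_one]; rfl
    change ((z : G ⧸ N) ^ k) ^ p = 1
    rw [← zpow_natCast, zpow_comm, zpow_natCast, this, one_zpow]
  let M := Z.comap (QuotientGroup.mk' N)
  have hNM : N ≤ M := fun x hx ↦ by
    change (x : G ⧸ N) ∈ Z
    rw [(QuotientGroup.eq_one_iff x).2 hx]
    exact one_mem _
  have hMo : IsOpen (M : Set G) := Subgroup.isOpen_mono hNM hN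
  have hlt : M.index < n := by
    have hZ : Nat.card Z = p := by
      rw [Nat.card_zpowers, Subgroup.orderOf_coe, hz]
    have h1 : M.index = Z.index :=
      Subgroup.index_comap_of_surjective _ (QuotientGroup.mk'_surjective N)
    have h2 : Nat.card Z * Z.index = n := by rw [Subgroup.card_mul_index, ← hn]; rfl
    have h3 : 0 < Z.index := Nat.pos_of_ne_zero Subgroup.index_ne_zero_of_finite
    rw [h1, ← h2, hZ]
    exact lt_mul_of_one_lt_left h3 hp.out.one_lt
  obtain ⟨i, hi⟩ := ih _ hlt M hMo (M.quotient_finite_of_isOpen hMo) rfl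
  refine ⟨i + 1, lowerPSeries_succ_le_of_isClosed (N.isClosed_of_isOpen hN) (fun x hx ↦ ?_)
    fun x hx g ↦ ?_⟩
  · exact (QuotientGroup.eq_one_iff (x ^ p)).1 (hZp _ (hi hx))
  · exact (commutatorElement_mem_iff_commute x g).2
      (Subgroup.mem_center_iff.1 (hZc (hi hx)) g).symm

theorem IsProP.eq_one_of_forall_mem (hG : IsProP p G) {x : G}
    (hx : ∀ N : Subgroup G, N.Normal → IsOpen (N : Set G) → x ∈ N) : x = 1 := by
  have := hG.compactSpace
  have := hG.totallyDisconnectedSpace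
  by_contra hne
  obtain ⟨H, hH⟩ := ProfiniteGrp.exist_openNormalSubgroup_sub_open_nhds_of_one
    (isOpen_compl_singleton (x := x)) (fun h ↦ hne (Set.mem_singleton_iff.1 h).symm)
  exact hH (hx H.toSubgroup H.isNormal' H.isOpen') rfl

theorem IsProP.pow_left_injective_of_coprime (hG : IsProP p G) {n : ℕ}
    (hn : n.Coprime p) {x y : G} (h : x ^ n = y ^ n) : x = y := by
  rw [← inv_mul_eq_one]
  refine hG.eq_one_of_forall_mem fun N hN hNo ↦ ?_
  obtain ⟨k, hk⟩ := hG.index_eq_pow N hN hNo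
  have hc : (Nat.card (G ⧸ N)).Coprime n := by
    change N.index.Coprime n
    rw [hk]
    exact (hn.pow_right k).symm
  rw [← QuotientGroup.eq]
  exact (powCoprime hc).injective (congrArg (QuotientGroup.mk' N) h)

end LowerPSeries

/-! ### The `p`-power map in powerful groups. -/

section Powerful

variable {p : ℕ} {G : Type*} [Group G] [TopologicalSpace G] [IsTopologicalGroup G]

/-- In a powerful pro-`2` group commutators go down two steps of the lower `2`-series. -/
theorem commutator_mem_lowerPSeries_add_two (hpow : IsPowerfulProP 2 G)
    (hopen : ∀ i, IsOpen (lowerPSeries 2 G i : Set G)) (i : ℕ) {x : G}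
    (hx : x ∈ lowerPSeries 2 G i) (g : G) : ⁅x, g⁆ ∈ lowerPSeries 2 G (i + 2) := by
  induction i generalizing x g with
  | zero =>
    have h4 : (powerSubgroup (⊤ : Subgroup G) 4).topologicalClosure ≤ lowerPSeries 2 G 2 := by
      refine Subgroup.topologicalClosure_minimal _ (powerSubgroup_le.2 fun y _ ↦ ?_)
        (isClosed_lowerPSeries 2)
      rw [show 4 = 2 * 2 from rfl, pow_mul]
      exact pow_mem_lowerPSeries_succ (pow_mem_lowerPSeries_succ (i := 0) (Subgroup.mem_top y))
    have := hpow (Subgroup.commutator_mem_commutator (Subgroup.mem_top x) (Subgroup.mem_top g))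
    rw [if_pos rfl] at this
    exact h4 this
  | succ i ih =>
    let N := lowerPSeries 2 G (i + 3)
    -- The elements whose commutators all lie in `N` form a closed subgroup, so only topological
    -- generators need checking.
    let Z := (Subgroup.center (G ⧸ N)).comap (QuotientGroup.mk' N)
    have hmem : ∀ y, y ∈ Z ↔ ∀ g, ⁅y, g⁆ ∈ N := fun y ↦ by
      simp only [commutatorElement_mem_iff_commute, Z, Subgroup.mem_comap, Subgroup.mem_center_iff]
      exact ⟨fun h g ↦ (h g).symm, fun h a ↦ by
        induction a using QuotientGroup.induction_on with | H a
        exact (h a).symm⟩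
    have hNZ : N ≤ Z := fun y hy ↦ (hmem y).2 fun g ↦
      Subgroup.commutator_le_left N ⊤ (Subgroup.commutator_mem_commutator hy (Subgroup.mem_top g))
    have hZ : IsClosed (Z : Set G) := Z.isClosed_of_isOpen (Subgroup.isOpen_mono hNZ (hopen _))
    have hcomm : ∀ y ∈ lowerPSeries 2 G i, ∀ g, ⁅y, g⁆ ∈ Z := fun y hy g ↦
      (hmem _).2 fun g' ↦ commutator_mem_lowerPSeries_succ (ih hy g) g'
    refine (hmem x).1 (lowerPSeries_succ_le_of_isClosed hZ (fun y hy ↦ (hmem _).2 fun g ↦ ?_)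
      hcomm hx) g
    have hid : ⁅y ^ 2, g⁆ = ⁅y, ⁅y, g⁆⁆ * ⁅y, g⁆ ^ 2 := by
      simp only [commutatorElement_def, sq]; group
    rw [hid]
    refine mul_mem ?_ (pow_mem_lowerPSeries_succ (ih hy g))
    rw [← commutatorElement_inv]
    exact inv_mem ((hmem _).1 (hcomm y hy g) y)

variable [hp : Fact p.Prime]

/-- Modulo `P (i + 2)`, the `p`-power map is multiplicative when one factor lies in `P i`. -/
theorem mul_pow_eq_mod_lowerPSeries (hpow : IsPowerfulProP p G)
    (hopen : ∀ i, IsOpen (lowerPSeries p G i : Set G)) {i : ℕ} (x : G) {w : G}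
    (hw : w ∈ lowerPSeries p G i) :
    (((x * w) ^ p : G) : G ⧸ lowerPSeries p G (i + 2)) = (x ^ p * w ^ p : G) := by
  let c := ⁅w⁻¹, x⁻¹⁆
  have hc : c ∈ lowerPSeries p G (i + 1) := commutator_mem_lowerPSeries_succ (inv_mem hw) _
  have hcen : ∀ a : G ⧸ lowerPSeries p G (i + 2), Commute (c : G ⧸ lowerPSeries p G (i + 2)) a :=
    fun a ↦ by
      induction a using QuotientGroup.induction_on with | H a
      exact (commutatorElement_mem_iff_commute c a).1 (commutator_mem_lowerPSeries_succ hc a)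
  have hrel : (w : G ⧸ lowerPSeries p G (i + 2)) * x = x * w * c := by
    have : w * x = x * w * c := by simp only [c, commutatorElement_def]; group
    exact_mod_cast congrArg (QuotientGroup.mk' (lowerPSeries p G (i + 2))) this
  -- For odd `p` the binomial is divisible by `p`; for `p = 2` it is 1, and `c` itself must vanish
  -- by the two-step descent.
  have hone : (c : G ⧸ lowerPSeries p G (i + 2)) ^ p.choose 2 = 1 := by
    rcases hp.out.eq_two_or_odd' with rfl | hodd
    · rw [(QuotientGroup.eq_one_iff c).2
        (commutator_mem_lowerPSeries_add_two hpow hopen i (inv_mem hw) _), one_pow]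
    · obtain ⟨m, hm⟩ : p ∣ p.choose 2 := hp.out.dvd_choose_self two_ne_zero
        (lt_of_le_of_ne hp.out.two_le (by rintro rfl; exact absurd hodd (by decide)))
      rw [hm, pow_mul]
      have : (c : G ⧸ lowerPSeries p G (i + 2)) ^ p = 1 :=
        (QuotientGroup.eq_one_iff (c ^ p)).2 (pow_mem_lowerPSeries_succ hc)
      rw [this, one_pow]
  have := mul_pow_of_central hcen hrel p
  rw [hone, mul_one] at this
  exact this

/-- The homomorphism `P i → G / P (i + 2)` induced by the `p`-power map. -/
def lowerPSeriesPowHom (hpow : IsPowerfulProP p G)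
    (hopen : ∀ i, IsOpen (lowerPSeries p G i : Set G)) (i : ℕ) :
    lowerPSeries p G i →* G ⧸ lowerPSeries p G (i + 2) where
  toFun w := ((w : G) ^ p : G)
  map_one' := by simp
  map_mul' x w := mul_pow_eq_mod_lowerPSeries hpow hopen (x : G) w.2

/-- Surjectivity of the power map. Powerfulness gives the base case. Inductively `y` is `w ^ p` up
to a factor central modulo P (i+3), and conjugating `w` by `g` gives `w * c`; so `⁅y, g⁆` is the
`p`-th power of `c⁻¹`. -/
theorem lowerPSeries_succ_le_comap_range (hpow : IsPowerfulProP p G)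
    (hopen : ∀ i, IsOpen (lowerPSeries p G i : Set G)) (i : ℕ) :
    lowerPSeries p G (i + 1) ≤
      (lowerPSeriesPowHom hpow hopen i).range.comap (QuotientGroup.mk' _) := by
  have hclosed : ∀ i, IsClosed (((lowerPSeriesPowHom hpow hopen i).range.comap
      (QuotientGroup.mk' _) : Subgroup G) : Set G) := fun i ↦ by
    refine Subgroup.isClosed_of_isOpen _
      (Subgroup.isOpen_mono (H₁ := lowerPSeries p G (i + 2)) (fun y hy ↦ ?_) (hopen (i + 2)))
    rw [Subgroup.mem_comap, QuotientGroup.mk'_apply, (QuotientGroup.eq_one_iff y).2 hy]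
    exact one_mem _
  have hpowmem : ∀ i, ∀ x ∈ lowerPSeries p G i, x ^ p ∈
      (lowerPSeriesPowHom hpow hopen i).range.comap (QuotientGroup.mk' _) :=
    fun i x hx ↦ ⟨⟨x, hx⟩, rfl⟩
  induction i with
  | zero =>
    refine lowerPSeries_succ_le_of_isClosed (hclosed 0) (hpowmem 0) fun x _ g ↦ ?_
    refine Subgroup.topologicalClosure_minimal _ (powerSubgroup_le.2 fun y _ ↦ ?_) (hclosed 0)
      (hpow (Subgroup.commutator_mem_commutator (Subgroup.mem_top x) (Subgroup.mem_top g)))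
    split_ifs with h2
    · have h4 : y ^ 4 = (y ^ 2) ^ p := by rw [h2, ← pow_mul]
      rw [h4]
      exact hpowmem 0 _ (Subgroup.mem_top _)
    · exact hpowmem 0 _ (Subgroup.mem_top _)
  | succ i ih =>
    refine lowerPSeries_succ_le_of_isClosed (hclosed _) (hpowmem _) fun y hy g ↦ ?_
    obtain ⟨w, hw⟩ := ih hy
    have hz : ((w : G) ^ p)⁻¹ * y ∈ lowerPSeries p G (i + 2) := QuotientGroup.eq.1 hw
    let c := (w : G)⁻¹ * (g * w * g⁻¹)
    have hc : c ∈ lowerPSeries p G (i + 1) := by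
      have : c = ⁅(w : G)⁻¹, g⁆ := by simp only [c, commutatorElement_def]; group
      rw [this]
      exact commutator_mem_lowerPSeries_succ (inv_mem w.2) g
    refine ⟨⟨c, hc⟩⁻¹, ?_⟩
    rw [map_inv]
    let q := QuotientGroup.mk' (lowerPSeries p G (i + 1 + 2))
    change (q (c ^ p))⁻¹ = q ⁅y, g⁆
    have hwc : q (g * (w : G) ^ p * g⁻¹) = q ((w : G) ^ p) * q (c ^ p) := by
      have : g * (w : G) ^ p * g⁻¹ = ((w : G) * c) ^ p := by
        rw [← conj_pow]; simp only [c]; group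
      rw [this, ← map_mul]
      exact mul_pow_eq_mod_lowerPSeries hpow hopen (w : G) hc
    have hcen : ∀ z ∈ lowerPSeries p G (i + 2), ∀ a, q z * q a = q a * q z := fun z hz a ↦
      (commutatorElement_mem_iff_commute z a).1 (commutator_mem_lowerPSeries_succ hz a)
    obtain ⟨z, hzmem, rfl⟩ : ∃ z ∈ lowerPSeries p G (i + 2), y = (w : G) ^ p * z :=
      ⟨_, hz, by group⟩
    have hcp := hcen _ (pow_mem_lowerPSeries_succ hc)
    have hconj : q g * q ((w : G) ^ p) = q ((w : G) ^ p) * q (c ^ p) * q g := by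
      rw [← hwc]; simp only [map_mul, map_inv]; group
    rw [map_commutatorElement, map_mul]
    exact (commutatorElement_mul_eq_inv (hcen z hzmem g) (hcp _) hconj).symm

end Powerful

/-! ### Unique roots in uniform groups. -/

section Uniform

variable {p : ℕ} [hp : Fact p.Prime] {U : Type*} [Group U] [TopologicalSpace U]
  [IsTopologicalGroup U]

theorem IsUniformProP.index_lowerPSeries_one_ne_zero (hU : IsUniformProP p U) :
    (lowerPSeries p U 1).index ≠ 0 := by
  have := finite_quotient_lowerPSeries_one hp.out.ne_zero hU.isTopFinGen
  exact Subgroup.index_ne_zero_of_finite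

theorem IsUniformProP.isOpen_lowerPSeries (hU : IsUniformProP p U) (i : ℕ) :
    IsOpen (lowerPSeries p U i : Set U) := by
  have hne : (lowerPSeries p U i).index ≠ 0 := by
    induction i with
    | zero => exact Subgroup.index_top.trans_ne one_ne_zero
    | succ i ih =>
      rw [← Subgroup.relIndex_mul_index (lowerPSeries_succ_le i), hU.relIndex_eq]
      exact mul_ne_zero hU.index_lowerPSeries_one_ne_zero ih
  have : (lowerPSeries p U i).FiniteIndex := ⟨hne⟩
  exact Subgroup.isOpen_of_isClosed_of_finiteIndex _ (isClosed_lowerPSeries i)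

/-- The kernel of the power map contains P (i+1) and, by surjectivity and uniformity, has the same
finite index in P i. -/
theorem IsUniformProP.mem_lowerPSeries_succ_of_pow_mem (hU : IsUniformProP p U) {i : ℕ} {w : U}
    (hw : w ∈ lowerPSeries p U i) (hwp : w ^ p ∈ lowerPSeries p U (i + 2)) :
    w ∈ lowerPSeries p U (i + 1) := by
  let f := lowerPSeriesPowHom hU.isPowerful hU.isOpen_lowerPSeries i
  have hle : (lowerPSeries p U (i + 1)).subgroupOf (lowerPSeries p U i) ≤ f.ker := fun x hx ↦
    (QuotientGroup.eq_one_iff ((x : U) ^ p)).2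
      (pow_mem_lowerPSeries_succ (Subgroup.mem_subgroupOf.1 hx))
  have hrange : f.range = (lowerPSeries p U (i + 1)).map (QuotientGroup.mk' _) := by
    refine le_antisymm ?_ (Subgroup.map_le_iff_le_comap.2
      (lowerPSeries_succ_le_comap_range hU.isPowerful hU.isOpen_lowerPSeries i))
    rintro _ ⟨x, rfl⟩
    exact ⟨(x : U) ^ p, pow_mem_lowerPSeries_succ x.2, rfl⟩
  have hindex : f.ker.index = (lowerPSeries p U 1).index := by
    rw [Subgroup.index_ker, hrange, ← Subgroup.relIndex_ker, QuotientGroup.ker_mk', hU.relIndex_eq]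
  have hmul := Subgroup.relIndex_mul_index hle
  rw [hindex, ← Subgroup.relIndex, hU.relIndex_eq] at hmul
  have hker := Subgroup.relIndex_eq_one.1
    ((mul_eq_right₀ hU.index_lowerPSeries_one_ne_zero).1 hmul)
  exact Subgroup.mem_subgroupOf.1 (hker (x := ⟨w, hw⟩) ((QuotientGroup.eq_one_iff (w ^ p)).2 hwp))

theorem IsUniformProP.pow_prime_injective (hU : IsUniformProP p U) {x y : U}
    (h : x ^ p = y ^ p) : x = y := by
  have hmem : ∀ i, x⁻¹ * y ∈ lowerPSeries p U i := fun i ↦ by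
    induction i with
    | zero => exact Subgroup.mem_top _
    | succ i ih =>
      refine hU.mem_lowerPSeries_succ_of_pow_mem ih ?_
      have := mul_pow_eq_mod_lowerPSeries hU.isPowerful hU.isOpen_lowerPSeries x ih
      rw [mul_inv_cancel_left, ← h, QuotientGroup.eq, inv_mul_cancel_left] at this
      exact this
  rw [← inv_mul_eq_one]
  refine hU.isProP.eq_one_of_forall_mem fun N hN hNo ↦ ?_
  obtain ⟨i, hi⟩ := exists_lowerPSeries_le hU.isProP N hNo
  exact hi (hmem i)

/-- Roots are unique in a uniform pro-`p` group. -/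
theorem IsUniformProP.pow_left_injective (hU : IsUniformProP p U) {n : ℕ} (hn : n ≠ 0) {x y : U}
    (h : x ^ n = y ^ n) : x = y := by
  obtain ⟨k, m, hm, rfl⟩ := Nat.exists_eq_pow_mul_and_not_dvd hn p hp.out.ne_one
  rw [mul_comm, pow_mul, pow_mul] at h
  have hinj : ∀ k : ℕ, ∀ a b : U, a ^ p ^ k = b ^ p ^ k → a = b := fun k ↦ by
    induction k with
    | zero => intro a b hab; simpa using hab
    | succ k ih =>
      intro a b hab
      rw [pow_succ, pow_mul, pow_mul] at hab
      exact ih a b (hU.pow_prime_injective hab)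
  exact hU.isProP.pow_left_injective_of_coprime
    ((hp.out.coprime_iff_not_dvd.2 hm).symm) (hinj k _ _ h)

theorem IsUniformProP.commute_of_commute_pow_left (hU : IsUniformProP p U) {n : ℕ} (hn : n ≠ 0)
    {x y : U} (h : Commute (x ^ n) y) : Commute x y := by
  have : (y * x * y⁻¹) ^ n = x ^ n := by rw [conj_pow, ← h.eq, mul_inv_cancel_right]
  exact (mul_inv_eq_iff_eq_mul.1 (hU.pow_left_injective hn this)).symm

end Uniform

theorem theorem2p4 (p : ℕ) [Fact p.Prime] (U : Type*) [Group U] [TopologicalSpace U]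
    [IsTopologicalGroup U] (hU : IsUniformProP p U) (G : Subgroup U)
    (hG : IsVirtuallyAbelian G) : IsMulCommutative G := by
  obtain ⟨A, hA, hfin⟩ := hG
  -- Normality is needed for the index-th power of every element to land in the subgroup.
  have hn : A.normalCore.index ≠ 0 := Subgroup.FiniteIndex.index_ne_zero
  have hmem : ∀ g : G, g ^ A.normalCore.index ∈ A := fun g ↦
    A.normalCore_le (A.normalCore.pow_index_mem g)
  refine ⟨⟨fun x y ↦ Subtype.ext ?_⟩⟩
  have hcomm : Commute ((x : U) ^ A.normalCore.index) ((y : U) ^ A.normalCore.index) := by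
    have := congrArg (fun a : A ↦ ((a : G) : U))
      (hA.is_comm.comm ⟨_, hmem x⟩ ⟨_, hmem y⟩)
    simpa [Commute, SemiconjBy] using this
  exact (hU.commute_of_commute_pow_left hn
    (hU.commute_of_commute_pow_left hn hcomm).symm).symm.eq
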